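/- \textbf{Definitions.} A \emph{proper cone} $K\subseteq\mathbb R^n$ is a nonempty convex set with $cK\subseteq K$ for all $c\ge 0$ that is closed, pointed ($K\cap(-K)=\{0\}$) and has nonempty interior $\operatorname{int}K$. For $a\in\mathbb R^n$ write $D_af=\sum_i a_i\,\partial f/\partial x_i$. A polynomial $g$ is \emph{log-concave} (resp. \emph{strictly log-concave}) at a point $x$ if $g(x)>0$ and the Hessian of $\log g$ at $x$ is negative semidefinite (resp. negative definite). A form $f\in\mathbb R[x_1,\dots,x_n]$ of degree $d\ge 2$ is \emph{$K$-Lorentzian} if for all $a_1,\dots,a_{d-2}\in\operatorname{int}K$ the symmetric matrix $Q$ of the quadratic form $D_{a_1}\cdots D_{a_{d-2}}f$ has exactly one positive eigenvalue (counted with multiplicity) and $y^{t}Qx>0$ for all $x,y\in\operatorname{int}K$. It is \emph{strictly $K$-Lorentzian} if moreover it is strictly $K$-completely log-concave: for all $0\le m\le d$, all $a_1,\dots,a_m\in K\setminus\{0\}$ and all $x\in K\setminus\{0\}$, the form $D_{a_1}\cdots D_{a_m}f$ is log-concave at $x$, and strictly log-concave at $x$ if $m\le d-2$. A form $f$ is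 \emph{Hurwitz-stable over $K$} if $f\equiv 0$ or, for all $x,v\in\operatorname{int}K$, all complex zeros of the univariate polynomial $t\mapsto f(x+tv)$ have negative real part. \textbf{Theorem.} Let $K\subseteq\mathbb R^n$ be a proper cone and let $f\in\mathbb R[x_1,\dots,x_n]$ be a strictly $K$-Lorentzian form of degree $d\ge 5$. Let $\alpha\approx 2.1479$ be the unique positive root of $t^3-t^2-2t-1$, and suppose that $$\bigl(D_v^kf(x)\bigr)^2>\frac{\sqrt{\alpha}\,k}{k+1}\,D_v^{k-1}f(x)\,D_v^{k+1}f(x)\qquad\text{for all }1\le k\le d-1\text{ and all }x,v\in\operatorname{int}K.$$ Then $f$ is Hurwitz-stable over $K$. -/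

import Mathlib

open MvPolynomial

/-- A proper cone in `ℝⁿ`: a nonempty convex set closed under scaling by all `c ≥ 0`, which is
topologically closed, pointed (`K ∩ -K = {0}`) and solid (nonempty interior). -/
structure IsProperConvexCone {n : ℕ} (K : Set (Fin n → ℝ)) : Prop where
  nonempty : K.Nonempty
  convex : Convex ℝ K
  smul_mem : ∀ c : ℝ, 0 ≤ c → ∀ x ∈ K, c • x ∈ K
  isClosed : IsClosed K
  pointed : ∀ x : Fin n → ℝ, (x ∈ K ∧ -x ∈ K) ↔ x = 0
  solid : (interior K).Nonempty

/-- The directional derivative `D_a f = ∑ i, a i * ∂f/∂x_i`. -/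
noncomputable def dirDeriv {n : ℕ} (a : Fin n → ℝ) (f : MvPolynomial (Fin n) ℝ) :
    MvPolynomial (Fin n) ℝ :=
  ∑ i, C (a i) * pderiv i f

/-- The mixed directional derivative `D_{a_1} ⋯ D_{a_m} f`. -/
noncomputable def mixedDirDeriv {n m : ℕ} (a : Fin m → Fin n → ℝ)
    (f : MvPolynomial (Fin n) ℝ) : MvPolynomial (Fin n) ℝ :=
  (List.ofFn a).foldr dirDeriv f

/-- `Q` is the (real symmetric) matrix of the quadratic form `q`, i.e. `q(x) = xᵗ Q x`. -/
def IsMatrixOfForm {n : ℕ} (Q : Matrix (Fin n) (Fin n) ℝ) (q : MvPolynomial (Fin n) ℝ) : Prop :=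
  Q.IsSymm ∧ ∀ x : Fin n → ℝ, eval x q = x ⬝ᵥ (Q.mulVec x)

/-- `Q` is symmetric and has exactly one positive eigenvalue, counted with multiplicity. -/
def HasOnePosEigenvalue {n : ℕ} (Q : Matrix (Fin n) (Fin n) ℝ) : Prop :=
  ∃ hQ : Q.IsHermitian, ∃! i, 0 < hQ.eigenvalues i

/-- `f` is a `K`-Lorentzian form of degree `d`. -/
def IsKLorentzian {n : ℕ} (K : Set (Fin n → ℝ)) (d : ℕ) (f : MvPolynomial (Fin n) ℝ) : Prop :=
  f.IsHomogeneous d ∧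
  (d ≤ 1 → ∀ x ∈ K, 0 ≤ eval x f) ∧
  (2 ≤ d → ∀ a : Fin (d - 2) → Fin n → ℝ, (∀ i, a i ∈ interior K) →
    ∃ Q : Matrix (Fin n) (Fin n) ℝ, IsMatrixOfForm Q (mixedDirDeriv a f) ∧
      HasOnePosEigenvalue Q ∧
      ∀ x ∈ interior K, ∀ y ∈ interior K, 0 < y ⬝ᵥ (Q.mulVec x))

/-- The Hessian form of `log f` at `x`, as a function of the vector `w`. -/
noncomputable def logHessian {n : ℕ} (f : MvPolynomial (Fin n) ℝ) (x w : Fin n → ℝ) : ℝ :=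
  iteratedFDeriv ℝ 2 (fun y : Fin n → ℝ => Real.log (eval y f)) x ![w, w]

/-- `f(x) > 0` and the Hessian of `log f` at `x` is negative semidefinite. -/
def IsLogConcaveAt {n : ℕ} (f : MvPolynomial (Fin n) ℝ) (x : Fin n → ℝ) : Prop :=
  0 < eval x f ∧ ∀ w : Fin n → ℝ, logHessian f x w ≤ 0

/-- `f(x) > 0` and the Hessian of `log f` at `x` is negative definite. -/
def IsStrictlyLogConcaveAt {n : ℕ} (f : MvPolynomial (Fin n) ℝ) (x : Fin n → ℝ) : Prop :=
  0 < eval x f ∧ ∀ w : Fin n → ℝ, w ≠ 0 → logHessian f x w < 0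

/-- A form `f` of degree `d` is strictly `K`-completely log-concave: every derivative
`D_{a_1} ⋯ D_{a_m} f` with `m ≤ d` and nonzero directions in `K` is log-concave at every nonzero
point of `K`, and strictly so if its degree `d - m` is at least `2`. (For `x = 0` or `a_i = 0` the
positivity cannot hold, and the logarithm of a form of degree at most `1` in two or more variables
never has a negative definite Hessian.) -/
def IsStrictlyKCLC {n : ℕ} (K : Set (Fin n → ℝ)) (d : ℕ) (f : MvPolynomial (Fin n) ℝ) : Prop :=
  ∀ m : ℕ, m ≤ d → ∀ a : Fin m → Fin n → ℝ, (∀ i, a i ∈ K ∧ a i ≠ 0) →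
    ∀ x ∈ K, x ≠ 0 →
      IsLogConcaveAt (mixedDirDeriv a f) x ∧
      (m + 2 ≤ d → IsStrictlyLogConcaveAt (mixedDirDeriv a f) x)

/-- A strictly `K`-Lorentzian form of degree `d`: a `K`-Lorentzian form that is strictly
`K`-completely log-concave. -/
def IsStrictlyKLorentzian {n : ℕ} (K : Set (Fin n → ℝ)) (d : ℕ)
    (f : MvPolynomial (Fin n) ℝ) : Prop :=
  IsKLorentzian K d f ∧ IsStrictlyKCLC K d f

/-- The univariate restriction `t ↦ f(x + t v)`. -/
noncomputable def lineRestriction {n : ℕ} (f : MvPolynomial (Fin n) ℝ) (x v : Fin n → ℝ) :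
    Polynomial ℝ :=
  aeval (fun i => Polynomial.C (x i) + Polynomial.C (v i) * Polynomial.X) f

/-- All complex zeros of `g` have negative real part. -/
def IsHurwitzStable (g : Polynomial ℝ) : Prop :=
  ∀ z : ℂ, Polynomial.aeval z g = 0 → z.re < 0

/-- `f` is Hurwitz-stable over `K`. -/
def IsHurwitzStableOver {n : ℕ} (K : Set (Fin n → ℝ)) (f : MvPolynomial (Fin n) ℝ) : Prop :=
  f = 0 ∨ ∀ x ∈ interior K, ∀ v ∈ interior K, IsHurwitzStable (lineRestriction f x v)

/-! A zero of `t ↦ f (x + t v)` with nonnegative real part becomes purely imaginary after moving `x`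
along `v` inside the cone. At `0` the value is positive; conjugation leaves only `ω * I` with `ω >
0`. There the terms `b k = c k * ω ^ k`, with `c k` the Taylor coefficients, are positive up to `d`
and satisfy `s * b k * b (k + 2) < b (k + 1) ^ 2`, where `s = √α` and `s ^ 3 = s ^ 2 + 1`.

`sum_mul_I_pow_ne_zero` excludes vanishing. Let `m` be the first index with `s * b (m + 2) ≤ b m`.
Along the parity class of `m` the terms rise up to `b m` and do not rise afterwards, and
`add_lt_of_newton` makes `b m` exceed the sum of its two neighbours, so that class has a nonzero
alternating sum. -/

/-- The alternating sum `b k - b (k - 2) + b (k - 4) - ⋯` along the parity class of `k`. -/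
def parityAltSum (b : ℕ → ℝ) : ℕ → ℝ
  | 0 => b 0
  | 1 => b 1
  | k + 2 => b (k + 2) - parityAltSum b k

/-- With the top power of `I` factored out, the two parity classes become the real and imaginary
parts. -/
theorem sum_mul_I_pow_eq (b : ℕ → ℝ) (N : ℕ) :
    ∑ k ∈ Finset.range (N + 2), (b k : ℂ) * Complex.I ^ k =
      Complex.I ^ (N + 1) *
        ((parityAltSum b (N + 1) : ℂ) - Complex.I * (parityAltSum b N : ℂ)) := by
  induction N with
  | zero =>
    simp only [Finset.sum_range_succ, parityAltSum, Finset.range_zero, Finset.sum_empty]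
    linear_combination (b 0 : ℂ) * Complex.I_sq
  | succ N ih =>
    rw [Finset.sum_range_succ, ih, parityAltSum]
    push_cast
    linear_combination
      (Complex.I ^ (N + 1) * (parityAltSum b (N + 1) : ℂ)) * Complex.I_sq

theorem parityAltSum_eq_zero {b : ℕ → ℝ} {N : ℕ}
    (h : ∑ k ∈ Finset.range (N + 2), (b k : ℂ) * Complex.I ^ k = 0) :
    parityAltSum b (N + 1) = 0 := by
  rw [sum_mul_I_pow_eq] at h
  have h' := (mul_eq_zero.1 h).resolve_left (pow_ne_zero _ Complex.I_ne_zero)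
  simpa using congrArg Complex.re h'

/-- With `s ^ 3 = s ^ 2 + 1`, a term dominating both neighbours by the factor `s`, and their
product by `s ^ 4`, exceeds their sum. -/
theorem add_lt_of_newton {s p q r : ℝ} (hs : 0 < s) (hs3 : s ^ 3 = s ^ 2 + 1)
    (hp : s * p < r) (hq : s * q ≤ r) (hpq : s ^ 4 * p * q < r ^ 2) (hp0 : 0 < p) :
    p + q < r := by
  -- The extremal case is `p = r / s ^ 3`, `q = r / s`, where `p + q = r` is exactly `s ^ 3 = s ^ 2
  -- + 1`. If `r ≤ p + q`, the product bound forces `s ^ 3 * p < r`, while `s * q ≤ r` forces `r ≤ s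
  -- ^ 3 * p`.
  by_contra! hge
  have h1 : s ^ 4 * p * (r - p) ≤ s ^ 4 * p * q :=
    mul_le_mul_of_nonneg_left (by linarith) (by positivity)
  have h2 : (r - s * p) * (s ^ 3 * p - r) = s ^ 4 * p * (r - p) - r ^ 2 := by
    linear_combination (-(s * p * r)) * hs3
  have h3 : s ^ 3 * p < r := by
    by_contra! h
    have := mul_nonneg (sub_nonneg.2 hp.le) (sub_nonneg.2 h)
    linarith
  have h4 : s ^ 2 * (s * (r - p)) ≤ s ^ 2 * r :=
    mul_le_mul_of_nonneg_left
      (le_trans (mul_le_mul_of_nonneg_left (by linarith) hs.le) hq) (by positivity)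
  have h5 : s ^ 3 * r = s ^ 2 * r + r := by rw [hs3]; ring
  linarith

/-! ### Newton sequences -/

/-- A finite positive sequence `b 0, …, b d` (extended by zero) satisfying the Newton-type
inequalities `s * b k * b (k + 2) < b (k + 1) ^ 2`. -/
structure IsNewtonSeq (s : ℝ) (d : ℕ) (b : ℕ → ℝ) : Prop where
  pos : ∀ k ≤ d, 0 < b k
  zero : ∀ k, d < k → b k = 0
  newton : ∀ k, k + 2 ≤ d → s * b k * b (k + 2) < b (k + 1) ^ 2

namespace IsNewtonSeq

variable {s : ℝ} {d : ℕ} {b : ℕ → ℝ}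

theorem nonneg (h : IsNewtonSeq s d b) (k : ℕ) : 0 ≤ b k := by
  rcases le_or_gt k d with hk | hk
  · exact (h.pos k hk).le
  · exact (h.zero k hk).ge

/-- Multiply the inequalities centred at `k + 1` and `k + 2` and cancel the common factor. -/
theorem newton_three (h : IsNewtonSeq s d b) (hs : 0 < s) (k : ℕ) (hk2 : k + 2 ≤ d) :
    s ^ 2 * b k * b (k + 3) < b (k + 1) * b (k + 2) := by
  rcases le_or_gt (k + 3) d with hk | hk
  · have h1 := h.newton k (by omega)
    have h2 := h.newton (k + 1) (by omega)
    have p0 := h.pos k (by omega)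
    have p1 := h.pos (k + 1) (by omega)
    have p2 := h.pos (k + 2) (by omega)
    have p3 := h.pos (k + 3) hk
    have h3 := mul_lt_mul'' h1 h2 (by positivity) (by positivity)
    refine lt_of_mul_lt_mul_right (a := b (k + 1) * b (k + 2)) ?_ (by positivity)
    simp only [add_assoc, Nat.reduceAdd] at h3
    linarith
  · rw [h.zero _ hk, mul_zero]
    exact mul_pos (h.pos _ (by omega)) (h.pos _ hk2)

theorem newton_four (h : IsNewtonSeq s d b) (hs : 0 < s) (k : ℕ) (hk2 : k + 3 ≤ d) :
    s ^ 4 * b k * b (k + 4) < b (k + 2) ^ 2 := by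
  have h1 := h.newton_three hs k (by omega)
  have h2 := h.newton_three hs (k + 1) hk2
  have p0 := h.nonneg k
  have p4 := h.nonneg (k + 4)
  have p1 := h.pos (k + 1) (by omega)
  have p2 := h.nonneg (k + 2)
  have p3 := h.pos (k + 3) hk2
  simp only [add_assoc, Nat.reduceAdd] at h2
  have h3 := mul_lt_mul'' h1 h2 (by positivity) (by positivity)
  refine lt_of_mul_lt_mul_right (a := b (k + 1) * b (k + 3)) ?_ (by positivity)
  linarith

/-- By `newton_three`, `b (k + 2) / b k` drops by more than a factor `s ^ 2` when `k` grows by one.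
-/
theorem ratio_step (h : IsNewtonSeq s d b) (hs : 1 ≤ s) (k : ℕ) (hk : s * b (k + 2) ≤ b k) :
    s * b (k + 3) ≤ b (k + 1) := by
  rcases le_or_gt (k + 3) d with hd | hd
  · have h1 := (h.newton_three (by linarith) k (by omega)).le
    have p2 := h.pos (k + 2) (by omega)
    have p3 := h.pos (k + 3) hd
    refine le_of_mul_le_mul_right (a := b (k + 2)) ?_ p2
    refine le_trans ?_ h1
    calc s * b (k + 3) * b (k + 2) = (1 * b (k + 3)) * (s * b (k + 2)) := by ring
      _ ≤ (s ^ 2 * b (k + 3)) * b k := by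
          gcongr
          exact one_le_pow₀ hs
      _ = _ := by ring
  · rw [h.zero _ hd, mul_zero]
    exact h.nonneg _

theorem ratio_step_back (h : IsNewtonSeq s d b) (hs : 0 < s) (k : ℕ)
    (hk : b (k + 1) < s * b (k + 3)) : s * b k < b (k + 2) := by
  have p3 : 0 < b (k + 3) :=
    pos_of_mul_pos_right ((h.nonneg (k + 1)).trans_lt hk) hs.le
  have hk2 : k + 2 ≤ d := by
    by_contra hd
    rw [h.zero (k + 3) (by omega)] at p3
    exact p3.false
  have h1 := h.newton_three hs k hk2
  have p2 := h.pos _ hk2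
  refine lt_of_mul_lt_mul_right (a := s * b (k + 3)) ?_ (by positivity)
  nlinarith [mul_lt_mul_of_pos_right hk p2]

/-- If `s ^ 3 = s ^ 2 + 1`, then a polynomial with Newton coefficient sequence
does not vanish at the imaginary unit. -/
theorem sum_mul_I_pow_ne_zero (h : IsNewtonSeq s d b) (hs : 0 < s) (hs3 : s ^ 3 = s ^ 2 + 1)
    (hd : 1 ≤ d) : ∑ k ∈ Finset.range (d + 1), (b k : ℂ) * Complex.I ^ k ≠ 0 := by
  have hs1 : 1 < s := by
    by_contra! hle
    nlinarith [mul_le_mul_of_nonneg_left hle (sq_nonneg s)]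
  intro hsum
  have hex : ∃ k, s * b (k + 2) ≤ b k :=
    ⟨d - 1, by rw [h.zero _ (by omega), mul_zero]; exact h.nonneg _⟩
  classical
  obtain ⟨m, hm, hmin⟩ : ∃ m, s * b (m + 2) ≤ b m ∧ ∀ k < m, b k < s * b (k + 2) :=
    ⟨Nat.find hex, Nat.find_spec hex, fun k hk => not_le.1 (Nat.find_min hex hk)⟩
  have hmd : m + 1 ≤ d := by
    by_contra hlt
    have := hmin (d - 1) (by omega)
    rw [h.zero (d - 1 + 2) (by omega), mul_zero] at this
    exact absurd (h.nonneg (d - 1)) (not_le.2 this)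
  have hup : ∀ j, s * b (m + j + 2) ≤ b (m + j) := by
    intro j
    induction j with
    | zero => exact hm
    | succ j ih => exact h.ratio_step hs1.le _ ih
  have hanti : ∀ j, b (m + j + 2) ≤ b (m + j) := fun j =>
    le_trans (le_mul_of_one_le_left (h.nonneg _) hs1.le) (hup j)
  -- Minimality is applied at `k + 1`, so at `k + 2 = m` it concerns `m - 1`.
  have hdown : ∀ k, k + 2 ≤ m → s * b k < b (k + 2) := fun k hk =>
    h.ratio_step_back hs k (hmin (k + 1) (by omega))
  have hbd : ∀ k ≤ m, 0 ≤ parityAltSum b k ∧ parityAltSum b k ≤ b k := by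
    intro k
    induction k using Nat.strong_induction_on with
    | _ k ih =>
      intro hk
      match k, ih, hk with
      | 0, _, _ => exact ⟨h.nonneg 0, le_rfl⟩
      | 1, _, _ => exact ⟨h.nonneg 1, le_rfl⟩
      | k + 2, ih, hk =>
        obtain ⟨h1, h2⟩ := ih k (by omega) (by omega)
        have h3 := hdown k hk
        have h4 := le_mul_of_one_le_left (h.nonneg k) hs1.le
        rw [parityAltSum]
        constructor <;> linarith
  have hpos : b (m + 2) < parityAltSum b m := by
    have pm := h.pos m (by omega)
    have hlt : b (m + 2) < b m := by
      rcases (h.nonneg (m + 2)).eq_or_lt with h0 | h0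
      · rwa [← h0]
      · exact lt_of_lt_of_le (lt_mul_of_one_lt_left h0 hs1) hm
    match m, hm, hmd, hdown, hbd, pm, hlt with
    | 0, _, _, _, _, _, hlt => exact hlt
    | 1, _, _, _, _, _, hlt => exact hlt
    | k + 2, hm, hmd, hdown, hbd, pm, hlt =>
      have h1 := hdown k le_rfl
      have h2 := (hbd k (by omega)).2
      have h3 := h.newton_four hs k hmd
      have p0 := h.pos k (by omega)
      rw [parityAltSum]
      simp only [add_assoc, Nat.reduceAdd] at hm hlt ⊢
      have := add_lt_of_newton hs hs3 h1 hm h3 p0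
      linarith
  -- Steps of four preserve the sign: the added pair `b (k + 4) - b (k + 2)` is absorbed by the
  -- surplus over `b (k + 2)`.
  have hfar : ∀ i, b (m + 4 * i + 2) < parityAltSum b (m + 4 * i) := by
    intro i
    induction i with
    | zero => exact hpos
    | succ i ih =>
      have e : m + 4 * (i + 1) = m + 4 * i + 2 + 2 := by ring
      have h1 := hanti (4 * i + 4)
      rw [e, parityAltSum, parityAltSum]
      have e2 : m + (4 * i + 4) = m + 4 * i + 2 + 2 := by ring
      rw [e2] at h1
      linarith
  -- Since `m + 4 * d ≥ d`, the sum up to this index is the full one, padded with zeros.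
  have hz : parityAltSum b (m + 4 * d) = 0 := by
    have hN : m + 4 * d = (m + 4 * d - 1) + 1 := by omega
    rw [hN]
    apply parityAltSum_eq_zero
    rw [← hsum]
    refine (Finset.sum_subset (Finset.range_subset_range.2 (by omega)) fun k _ hk => ?_).symm
    rw [h.zero k (by simpa using hk)]
    simp
  have := hfar d
  rw [hz] at this
  exact absurd (h.nonneg _) (not_le.2 this)

end IsNewtonSeq

/-! ### Restriction to lines -/

theorem iterate_dirDeriv_eq_mixedDirDeriv {n : ℕ} (v : Fin n → ℝ) (f : MvPolynomial (Fin n) ℝ)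
    (m : ℕ) : mixedDirDeriv (fun _ : Fin m => v) f = (dirDeriv v)^[m] f := by
  rw [mixedDirDeriv, List.ofFn_const]
  induction m with
  | zero => rfl
  | succ m ih => rw [List.replicate_succ, List.foldr_cons, ih, Function.iterate_succ_apply']

theorem dirDeriv_mul {n : ℕ} (v : Fin n → ℝ) (p q : MvPolynomial (Fin n) ℝ) :
    dirDeriv v (p * q) = dirDeriv v p * q + p * dirDeriv v q := by
  simp only [dirDeriv, Finset.sum_mul, Finset.mul_sum, ← Finset.sum_add_distrib]
  refine Finset.sum_congr rfl fun i _ => ?_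
  rw [Derivation.leibniz, smul_eq_mul, smul_eq_mul]
  ring

theorem derivative_lineRestriction {n : ℕ} (f : MvPolynomial (Fin n) ℝ) (x v : Fin n → ℝ) :
    Polynomial.derivative (lineRestriction f x v) = lineRestriction (dirDeriv v f) x v := by
  induction f using MvPolynomial.induction_on with
  | C a => simp [lineRestriction, dirDeriv]
  | add p q hp hq =>
    simp only [lineRestriction, dirDeriv, map_add, mul_add, Finset.sum_add_distrib] at *
    rw [hp, hq]
  | mul_X p i hp =>
    have hX : dirDeriv v (X i : MvPolynomial (Fin n) ℝ) = C (v i) := by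
      simp [dirDeriv, pderiv_X, Pi.single_apply]
    rw [dirDeriv_mul, hX]
    simp only [lineRestriction, map_add, map_mul] at hp ⊢
    rw [Polynomial.derivative_mul, hp]
    simp

theorem coeff_zero_lineRestriction {n : ℕ} (f : MvPolynomial (Fin n) ℝ) (x v : Fin n → ℝ) :
    (lineRestriction f x v).coeff 0 = eval x f := by
  rw [Polynomial.coeff_zero_eq_aeval_zero, lineRestriction, ← AlgHom.comp_apply,
    MvPolynomial.comp_aeval, ← MvPolynomial.coe_aeval_eq_eval]
  simp

theorem factorial_mul_coeff_lineRestriction {n : ℕ} (f : MvPolynomial (Fin n) ℝ)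
    (x v : Fin n → ℝ) (k : ℕ) :
    (k.factorial : ℝ) * (lineRestriction f x v).coeff k = eval x ((dirDeriv v)^[k] f) := by
  have h : Polynomial.derivative^[k] (lineRestriction f x v) =
      lineRestriction ((dirDeriv v)^[k] f) x v := by
    induction k with
    | zero => rfl
    | succ k ih =>
      rw [Function.iterate_succ_apply', ih, derivative_lineRestriction,
        Function.iterate_succ_apply']
  rw [← coeff_zero_lineRestriction _ x v, ← h, Polynomial.coeff_iterate_derivative,
    zero_add, Nat.descFactorial_self, nsmul_eq_mul]

theorem natDegree_lineRestriction_le {n d : ℕ} {f : MvPolynomial (Fin n) ℝ}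
    (hf : f.IsHomogeneous d) (x v : Fin n → ℝ) : (lineRestriction f x v).natDegree ≤ d := by
  have h := MvPolynomial.aeval_natDegree_le f hf.totalDegree_le
    (fun i => Polynomial.C (x i) + Polynomial.C (v i) * Polynomial.X) (n := 1) fun i => by
      compute_degree
  simpa [lineRestriction] using h

theorem aeval_lineRestriction {n : ℕ} (f : MvPolynomial (Fin n) ℝ) (x v : Fin n → ℝ) (z : ℂ) :
    Polynomial.aeval z (lineRestriction f x v) =
      aeval (fun i => (x i : ℂ) + (v i : ℂ) * z) f := by
  rw [lineRestriction, ← AlgHom.comp_apply, MvPolynomial.comp_aeval]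
  simp

theorem aeval_lineRestriction_add_smul {n : ℕ} (f : MvPolynomial (Fin n) ℝ) (x v : Fin n → ℝ)
    (t : ℝ) (z : ℂ) :
    Polynomial.aeval z (lineRestriction f (x + t • v) v) =
      Polynomial.aeval (t + z) (lineRestriction f x v) := by
  rw [aeval_lineRestriction, aeval_lineRestriction]
  congr 2
  funext i
  simp only [Pi.add_apply, Pi.smul_apply, smul_eq_mul]
  push_cast
  ring

/-! ### Interior of a proper cone -/

namespace IsProperConvexCone

variable {n : ℕ} {K : Set (Fin n → ℝ)}

theorem add_mem (hK : IsProperConvexCone K) {x y : Fin n → ℝ} (hx : x ∈ K) (hy : y ∈ K) :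
    x + y ∈ K := by
  have h := hK.smul_mem 2 (by norm_num) _
    (hK.convex hx hy (a := 1 / 2) (b := 1 / 2) (by norm_num) (by norm_num) (by norm_num))
  rw [smul_add, smul_smul, smul_smul] at h
  norm_num at h
  exact h

theorem add_mem_interior (hK : IsProperConvexCone K) {x y : Fin n → ℝ} (hx : x ∈ interior K)
    (hy : y ∈ K) : x + y ∈ interior K := by
  have hsub : (fun z => z + y) '' interior K ⊆ interior K := by
    refine interior_maximal ?_ ((Homeomorph.addRight y).isOpenMap _ isOpen_interior)
    rintro _ ⟨z, hz, rfl⟩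
    exact hK.add_mem (interior_subset hz) hy
  exact hsub ⟨x, hx, rfl⟩

/-- A ball around `0` would contain opposite nonzero vectors. The index `i` ensures `n > 0`; for `n
= 0` the claim fails. -/
theorem ne_zero_of_mem_interior (hK : IsProperConvexCone K) (i : Fin n) {x : Fin n → ℝ}
    (hx : x ∈ interior K) : x ≠ 0 := by
  rintro rfl
  obtain ⟨ε, hε, hball⟩ := Metric.mem_nhds_iff.1 (mem_interior_iff_mem_nhds.1 hx)
  have hnorm : ‖(Pi.single i (ε / 2) : Fin n → ℝ)‖ < ε := by
    rw [Pi.norm_single, Real.norm_of_nonneg (by positivity)]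
    linarith
  have h := (hK.pointed (Pi.single i (ε / 2))).1
    ⟨hball (by simpa using hnorm), hball (by simpa using hnorm)⟩
  have := congrFun h i
  rw [Pi.single_eq_same, Pi.zero_apply] at this
  linarith

end IsProperConvexCone

/-! ### From derivatives to stability -/

/-- The coefficients of a real polynomial, rescaled by powers of `ω > 0`, form a Newton sequence
as soon as the derivatives at zero satisfy the corresponding Newton-type inequalities. -/
theorem isNewtonSeq_coeff_mul_pow {n d : ℕ} {f : MvPolynomial (Fin n) ℝ} {x v : Fin n → ℝ}
    {s ω : ℝ} (hf : f.IsHomogeneous d) (hω : 0 < ω)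
    (hpos : ∀ k ≤ d, 0 < eval x ((dirDeriv v)^[k] f))
    (hN : ∀ k : ℕ, 1 ≤ k → k ≤ d - 1 →
      (s * (k : ℝ) / ((k : ℝ) + 1)) * eval x ((dirDeriv v)^[k - 1] f) *
          eval x ((dirDeriv v)^[k + 1] f) < (eval x ((dirDeriv v)^[k] f)) ^ 2) :
    IsNewtonSeq s d fun k => (lineRestriction f x v).coeff k * ω ^ k where
  pos k hk := by
    have h := hpos k hk
    rw [← factorial_mul_coeff_lineRestriction] at h
    exact mul_pos (pos_of_mul_pos_right h (Nat.cast_nonneg _)) (pow_pos hω k)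
  zero k hk := by
    rw [Polynomial.coeff_eq_zero_of_natDegree_lt
      ((natDegree_lineRestriction_le hf x v).trans_lt hk), zero_mul]
  newton k hk := by
    have h := hN (k + 1) (by omega) (by omega)
    simp only [← factorial_mul_coeff_lineRestriction, Nat.add_sub_cancel, add_assoc,
      Nat.reduceAdd] at h
    set c := (lineRestriction f x v).coeff
    have hfac : (0 : ℝ) < (k.factorial : ℝ) := by positivity
    have h1 : ((k + 1).factorial : ℝ) = (k + 1) * k.factorial := by
      rw [Nat.factorial_succ]; push_cast; ring
    have h2 : ((k + 2).factorial : ℝ) = (k + 2) * ((k + 1) * k.factorial) := by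
      rw [Nat.factorial_succ, Nat.cast_mul, h1]; push_cast; ring
    rw [h1, h2] at h
    -- The factor `(k + 1) / (k + 2)` turns `k! * (k + 2)!` into `(k + 1)! ^ 2`.
    have h3 : ((k + 1 : ℝ) * k.factorial) ^ 2 * (s * c k * c (k + 2)) <
        ((k + 1 : ℝ) * k.factorial) ^ 2 * c (k + 1) ^ 2 := by
      convert h using 1
      · push_cast
        field_simp
        ring
      · ring
    have h4 := lt_of_mul_lt_mul_left h3 (by positivity)
    calc s * (c k * ω ^ k) * (c (k + 2) * ω ^ (k + 2))
        = (s * c k * c (k + 2)) * (ω ^ (k + 1)) ^ 2 := by ring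
      _ < c (k + 1) ^ 2 * (ω ^ (k + 1)) ^ 2 := mul_lt_mul_of_pos_right h4 (by positivity)
      _ = _ := by ring

theorem aeval_mul_I_ne_zero_of_isNewtonSeq {s ω : ℝ} {d : ℕ} {p : Polynomial ℝ}
    (hs : 0 < s) (hs3 : s ^ 3 = s ^ 2 + 1) (hd : 1 ≤ d) (hp : p.natDegree ≤ d)
    (h : IsNewtonSeq s d fun k => p.coeff k * ω ^ k) :
    Polynomial.aeval ((ω : ℂ) * Complex.I) p ≠ 0 := by
  rw [Polynomial.aeval_eq_sum_range' (Nat.lt_succ_of_le hp)]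
  convert h.sum_mul_I_pow_ne_zero hs hs3 hd using 3 with k
  rw [Complex.real_smul, mul_pow]
  push_cast
  ring

/-- The cubic reads `α ^ 3 = (α + 1) ^ 2`; take square roots. -/
theorem sqrt_pow_three_eq {α : ℝ} (hα : 0 < α) (h : α ^ 3 - α ^ 2 - 2 * α - 1 = 0) :
    √α ^ 3 = √α ^ 2 + 1 := by
  have hs : 0 < √α := Real.sqrt_pos.2 hα
  have h2 : √α ^ 2 = α := Real.sq_sqrt hα.le
  refine (pow_left_inj₀ (by positivity) (by positivity) two_ne_zero).1 ?_
  have h6 : (√α ^ 3) ^ 2 = (√α ^ 2) ^ 3 := by ring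
  rw [h6, h2]
  linarith

theorem mainTheorem8 {n : ℕ} (K : Set (Fin n → ℝ)) (hK : IsProperConvexCone K)
    (d : ℕ) (hd : 5 ≤ d) (f : MvPolynomial (Fin n) ℝ) (hf : IsStrictlyKLorentzian K d f)
    (α : ℝ) (hα_pos : 0 < α) (hα_root : α ^ 3 - α ^ 2 - 2 * α - 1 = 0)
    (hNewton : ∀ k : ℕ, 1 ≤ k → k ≤ d - 1 → ∀ x ∈ interior K, ∀ v ∈ interior K,
      (Real.sqrt α * (k : ℝ) / ((k : ℝ) + 1)) *
          MvPolynomial.eval x ((dirDeriv v)^[k - 1] f) *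
          MvPolynomial.eval x ((dirDeriv v)^[k + 1] f)
        < (MvPolynomial.eval x ((dirDeriv v)^[k] f)) ^ 2) :
    IsHurwitzStableOver K f := by
  obtain ⟨⟨hhom, -, hlor⟩, hclc⟩ := hf
  obtain ⟨u, hu⟩ := hK.solid
  -- The index of the positive eigenvalue shows `n > 0`.
  obtain ⟨-, -, ⟨-, i, -, -⟩, -⟩ := hlor (by omega) (fun _ => u) fun _ => hu
  have hs : 0 < √α := Real.sqrt_pos.2 hα_pos
  have hs3 := sqrt_pow_three_eq hα_pos hα_root
  have hpos : ∀ x ∈ interior K, ∀ v ∈ interior K, ∀ k ≤ d,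
      0 < eval x ((dirDeriv v)^[k] f) := by
    intro x hx v hv k hk
    rw [← iterate_dirDeriv_eq_mixedDirDeriv]
    exact (hclc k hk (fun _ => v)
      (fun _ => ⟨interior_subset hv, hK.ne_zero_of_mem_interior i hv⟩) x (interior_subset hx)
      (hK.ne_zero_of_mem_interior i hx)).1.1
  have himag : ∀ x ∈ interior K, ∀ v ∈ interior K, ∀ ω : ℝ, 0 < ω →
      Polynomial.aeval ((ω : ℂ) * Complex.I) (lineRestriction f x v) ≠ 0 :=
    fun x hx v hv ω hω => aeval_mul_I_ne_zero_of_isNewtonSeq hs hs3 (by omega)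
      (natDegree_lineRestriction_le hhom x v) (isNewtonSeq_coeff_mul_pow hhom hω
        (hpos x hx v hv) fun k hk1 hk2 => hNewton k hk1 hk2 x hx v hv)
  refine Or.inr fun x hx v hv z hz => ?_
  by_contra! hre
  have hy : x + z.re • v ∈ interior K :=
    hK.add_mem_interior hx (hK.smul_mem _ hre _ (interior_subset hv))
  have hroot : Polynomial.aeval ((z.im : ℂ) * Complex.I)
      (lineRestriction f (x + z.re • v) v) = 0 := by
    rw [aeval_lineRestriction_add_smul, Complex.re_add_im, hz]
  rcases lt_trichotomy z.im 0 with him | him | him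
  · refine himag _ hy v hv (-z.im) (neg_pos.2 him) ?_
    have hconj : ((-z.im : ℝ) : ℂ) * Complex.I =
        (starRingEnd ℂ) ((z.im : ℂ) * Complex.I) := by simp
    rw [hconj, Polynomial.aeval_conj, hroot, map_zero]
  · have h0 := hpos _ hy v hv 0 (Nat.zero_le d)
    rw [him, Complex.ofReal_zero, zero_mul, ← Polynomial.coeff_zero_eq_aeval_zero',
      coeff_zero_lineRestriction] at hroot
    exact h0.ne' (by simpa using hroot)
  · exact himag _ hy v hv _ him hroot
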